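/- Let $X$ be a separable real Banach space and let $\lambda>0$. Consider the following three properties. * $X$ has the *Lipschitz $\pi_\lambda$-property* if there are convex sets $C_1\subseteq C_2\subseteq\cdots\subseteq X$ with $0\in C_n$ and $\dim\operatorname{span}(C_n)<\infty$ for every $n$, such that $X=\overline{\bigcup_n \operatorname{span}(C_n)}$ and such that for every $n$ there is a $\lambda$-Lipschitz retraction of $X$ onto $C_n$, i.e. a $\lambda$-Lipschitz map $R_n:X\to C_n$ with $R_n(x)=x$ for all $x\in C_n$. * $X$ has the *$\pi_\lambda$-property (with increasing ranges)* if there is a sequence $(S_n)$ of finite rank bounded linear projections on $X$ with $\|S_n\|\le\lambda$ for all $n$, $S_nx\to x$ for every $x\in X$, and $S_mS_n=S_n$ whenever $m\ge n$. * $X$ has the *$\pi_\lambda$-property (for nets)* if there is a net $(S_\alpha)$ of finite rank bounded linear projections on $X$ with $\|S_\alpha\|\le\lambda$ for all $\alpha$ and $S_\alpha x\to x$ for every $x\in X$. Then: 1. $X$ has the Lipschitz $\pi_\lambda$-property if and only if it has the $\pi_\lambda$-property with increasing ranges. 2. If $X$ has the Lipschitz $\pi_\lambda$-property, then it has the $\pi_\lambda$-property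 for nets. 3. If $X$ has the $\pi_\lambda$-property for nets, then it has the Lipschitz $\pi_\mu$-property for every $\mu>\lambda$. -/

import Mathlib

open Filter Topology
open scoped NNReal

/-- The `π_lam`-property, as a net: finite rank (linear, continuous) projections `S i` on `X`, indexed
by a nonempty directed set, bounded in norm by `lam`, converging strongly to the identity. -/
def HasPiProperty.{u} (X : Type u) [NormedAddCommGroup X] [NormedSpace ℝ X] (lam : ℝ≥0) : Prop :=
  ∃ (ι : Type u) (_ : Preorder ι) (_ : IsDirectedOrder ι) (_ : Nonempty ι) (S : ι → X →L[ℝ] X),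
    (∀ i, S i ∘L S i = S i) ∧
    (∀ i, FiniteDimensional ℝ (S i).range) ∧
    (∀ i, ‖S i‖ ≤ lam) ∧
    ∀ x : X, Tendsto (fun i => S i x) atTop (𝓝 x)

/-- The `π_lam`-property with increasing ranges: a sequence of finite rank projections
bounded in norm by `lam`, converging pointwise to the identity, with
`S m (S n x) = S n x` whenever `n ≤ m`. -/
def HasIncreasingPiProperty (X : Type*) [NormedAddCommGroup X] [NormedSpace ℝ X]
    (lam : ℝ≥0) : Prop :=
  ∃ S : ℕ → X →L[ℝ] X,
    (∀ n, S n ∘L S n = S n) ∧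
    (∀ n, FiniteDimensional ℝ (S n).range) ∧
    (∀ n, ‖S n‖ ≤ lam) ∧
    (∀ x : X, Tendsto (fun n => S n x) atTop (𝓝 x)) ∧
    ∀ n m, n ≤ m → S m ∘L S n = S n

/-- `R : X → X` is a `lam`-Lipschitz retraction of `X` onto the subset `C`. -/
def IsLipschitzRetractionOnto {X : Type*} [PseudoEMetricSpace X] (lam : ℝ≥0) (C : Set X)
    (R : X → X) : Prop :=
  LipschitzWith lam R ∧ (∀ x, R x ∈ C) ∧ ∀ x ∈ C, R x = x

/-- The Lipschitz `π_lam`-property: an increasing sequence of finite-dimensional convex sets that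
contain `0`, whose spans have dense union, each of them a `lam`-Lipschitz retract of `X`. -/
def HasLipschitzPiProperty (X : Type*) [NormedAddCommGroup X] [NormedSpace ℝ X]
    (lam : ℝ≥0) : Prop :=
  ∃ C : ℕ → Set X,
    Monotone C ∧
    (∀ n, Convex ℝ (C n)) ∧
    (∀ n, (0 : X) ∈ C n) ∧
    (∀ n, FiniteDimensional ℝ (Submodule.span ℝ (C n))) ∧
    closure (⋃ n, (Submodule.span ℝ (C n) : Set X)) = Set.univ ∧
    ∀ n, ∃ R : X → X, IsLipschitzRetractionOnto lam (C n) R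

/-! Ranges of increasing projections serve as the sets `C n`. Conversely, blowing up a retraction
onto `C n` about a relative interior point gives, in the limit, a Lipschitz retraction onto the
finite-dimensional span. The commuting maps `G ↦ G (· + y) - G y` act on such retractions, and a
common fixed point is additive, hence a linear projection with the same constant
(`exists_projection_of_lipschitz_retraction`).

For nets, conjugating a projection by an operator close to the identity makes it fix a given
finite-dimensional subspace, at an arbitrarily small cost in norm
(`exists_projection_fixing_of_net`). Iterating along a dense sequence makes the ranges increase. -/

open scoped Pointwise in
/-- **Markov–Kakutani**: commuting continuous linear maps preserving a nonempty compact convex set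
have a common fixed point in it. -/
theorem exists_common_fixedPoint_of_commute {E : Type*} [AddCommGroup E] [Module ℝ E]
    [TopologicalSpace E] [IsTopologicalAddGroup E] [ContinuousSMul ℝ E] [T2Space E]
    {K : Set E} (hK : IsCompact K) (hconv : Convex ℝ K) (hne : K.Nonempty)
    {ι : Type*} (T : ι → E →L[ℝ] E) (hcomm : ∀ i j, Commute (T i) (T j))
    (hmaps : ∀ i, Set.MapsTo (T i) K K) : ∃ x ∈ K, ∀ i, T i x = x := by
  classical
  let A : ι × ℕ → E →L[ℝ] E := fun p =>
    ((p.2 + 1 : ℕ) : ℝ)⁻¹ • ∑ k ∈ Finset.range (p.2 + 1), T p.1 ^ k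
  have hAcomm : ∀ p q, Commute (A p) (A q) := fun p q =>
    ((Commute.sum_right _ _ _ fun k _ => Commute.sum_left _ _ _ fun l _ =>
      (hcomm _ _).pow_pow _ _).smul_left _).smul_right _
  have hpow : ∀ i k, ∀ x ∈ K, (T i ^ k) x ∈ K := by
    intro i k
    induction k with
    | zero => intro x hx; simpa using hx
    | succ k ih => intro x hx; rw [pow_succ]; exact ih _ (hmaps i hx)
  have hAmaps : ∀ p, Set.MapsTo (A p) K K := by
    intro p x hx
    have : A p x = ∑ k ∈ Finset.range (p.2 + 1), ((p.2 + 1 : ℕ) : ℝ)⁻¹ • (T p.1 ^ k) x := by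
      simp [A, Finset.smul_sum]
    rw [this]
    refine hconv.sum_mem (fun _ _ => by positivity) ?_ fun k _ => hpow _ _ x hx
    rw [Finset.sum_const, Finset.card_range, nsmul_eq_mul]
    exact mul_inv_cancel₀ (by positivity)
  have key : ∀ u : Finset (ι × ℕ), ∃ B : E →L[ℝ] E, Set.MapsTo B K K ∧ (∀ p, Commute (A p) B) ∧
      ∀ p ∈ u, B '' K ⊆ A p '' K := by
    intro u
    induction u using Finset.induction_on with
    | empty => exact ⟨1, fun x hx => hx, fun p => Commute.one_right _, by simp⟩
    | insert p u _ ih =>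
      obtain ⟨B, hB, hBc, hBu⟩ := ih
      -- Since the averages commute, any factor can be moved to the front, so the image of the
      -- product lies in the image of each factor.
      refine ⟨A p * B, fun x hx => hAmaps p (hB hx),
        fun q => (hAcomm q p).mul_right (hBc q), fun q hq => ?_⟩
      rcases Finset.mem_insert.1 hq with rfl | hq
      · rintro _ ⟨x, hx, rfl⟩
        exact ⟨B x, hB hx, rfl⟩
      · rintro _ ⟨x, hx, rfl⟩
        refine hBu q hq ⟨A p x, hAmaps p hx, ?_⟩
        rw [(hBc p).eq]
        rfl
  obtain ⟨x, hxK, hx⟩ := hK.inter_iInter_nonempty (fun p => A p '' K)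
    (fun p => (hK.image (A p).continuous).isClosed) (fun u => by
      obtain ⟨B, hB, -, hBu⟩ := key u
      obtain ⟨y, hy⟩ := hne
      exact ⟨B y, hB hy, Set.mem_iInter₂.2 fun p hp => hBu p hp ⟨y, hy, rfl⟩⟩)
  refine ⟨x, hxK, fun i => ?_⟩
  rw [Set.mem_iInter] at hx
  choose y hyK hy using fun n : ℕ => hx (i, n)
  -- The geometric sum telescopes; the left side tends to `0` because `K - K` is bounded, while the
  -- right side does not depend on `n`.
  have hdiff : ∀ n : ℕ, ((n + 1 : ℕ) : ℝ)⁻¹ • ((T i ^ (n + 1)) (y n) - y n) = T i x - x := by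
    intro n
    have h : (T i - 1) * A (i, n) = ((n + 1 : ℕ) : ℝ)⁻¹ • (T i ^ (n + 1) - 1) := by
      simp only [A]
      rw [mul_smul_comm, mul_geom_sum]
    have := congrArg (fun L : E →L[ℝ] E => L (y n)) h
    rw [← hy n]
    exact this.symm
  have hKb : Bornology.IsVonNBounded ℝ (K - K) := by
    let := IsTopologicalAddGroup.rightUniformSpace E
    have := isUniformAddGroup_of_addCommGroup (G := E)
    exact ((hK.isVonNBounded ℝ).sub (hK.isVonNBounded ℝ))
  have hlim : Tendsto (fun n : ℕ => ((n + 1 : ℕ) : ℝ)⁻¹ • ((T i ^ (n + 1)) (y n) - y n))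
      atTop (𝓝 0) := by
    refine hKb.smul_tendsto_zero (Eventually.of_forall fun n =>
      Set.sub_mem_sub (hpow i _ _ (hyK n)) (hyK n)) ?_
    exact (tendsto_inv_atTop_nhds_zero_nat (𝕜 := ℝ)).comp (tendsto_add_atTop_nat 1)
  simp only [hdiff] at hlim
  exact sub_eq_zero.1 (tendsto_nhds_unique tendsto_const_nhds hlim)

/-! ### Translation operators on spaces of maps -/

/-- The map `G ↦ G (· + y) - G y` on functions. -/
def translateSub {X V : Type*} [AddCommGroup X] [NormedAddCommGroup V] [NormedSpace ℝ V] (y : X) :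
    (X → V) →L[ℝ] (X → V) :=
  ContinuousLinearMap.pi fun x =>
    (ContinuousLinearMap.proj (R := ℝ) (φ := fun _ : X => V) (x + y) -
      ContinuousLinearMap.proj (R := ℝ) (φ := fun _ : X => V) y)

@[simp]
theorem translateSub_apply {X V : Type*} [AddCommGroup X] [NormedAddCommGroup V] [NormedSpace ℝ V]
    (y : X) (G : X → V) (x : X) : translateSub y G x = G (x + y) - G y := rfl

theorem translateSub_commute {X V : Type*} [AddCommGroup X] [NormedAddCommGroup V]
    [NormedSpace ℝ V] (y z : X) :
    Commute (translateSub y : (X → V) →L[ℝ] (X → V)) (translateSub z) := by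
  ext G x
  simp [add_right_comm x y z, add_comm y z]

/-! ### From Lipschitz retractions to linear projections -/

section Retraction

theorem convex_lipschitzMaps (lam : ℝ≥0) (X V : Type*) [NormedAddCommGroup X]
    [NormedAddCommGroup V] [NormedSpace ℝ V] :
    Convex ℝ {G : X → V | ∀ x y, ‖G x - G y‖ ≤ lam * ‖x - y‖} := by
  intro G hG H hH a b ha hb hab x y
  calc ‖(a • G + b • H) x - (a • G + b • H) y‖ = ‖a • (G x - G y) + b • (H x - H y)‖ := by
        congr 1; simp only [Pi.add_apply, Pi.smul_apply, smul_sub]; abel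
    _ ≤ a * ‖G x - G y‖ + b * ‖H x - H y‖ := by
        refine (norm_add_le _ _).trans_eq ?_
        rw [norm_smul, norm_smul, Real.norm_of_nonneg ha, Real.norm_of_nonneg hb]
    _ ≤ a * (lam * ‖x - y‖) + b * (lam * ‖x - y‖) :=
        add_le_add (mul_le_mul_of_nonneg_left (hG x y) ha) (mul_le_mul_of_nonneg_left (hH x y) hb)
    _ = lam * ‖x - y‖ := by rw [← add_mul, hab, one_mul]

variable {X : Type*} [NormedAddCommGroup X] [NormedSpace ℝ X]

/-- The `lam`-Lipschitz maps `X → V` that fix the vectors of `V` of norm at most `r`. -/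
def lipschitzFixing (lam : ℝ≥0) (V : Submodule ℝ X) (r : ℝ) : Set (X → V) :=
  {G | (∀ x y, ‖G x - G y‖ ≤ lam * ‖x - y‖) ∧ ∀ v : V, ‖v‖ ≤ r → G v = v}

theorem isClosed_lipschitzFixing (lam : ℝ≥0) (V : Submodule ℝ X) (r : ℝ) :
    IsClosed (lipschitzFixing lam V r) := by
  simp only [lipschitzFixing, Set.ofPred_and, Set.ofPred_forall]
  refine (isClosed_iInter fun x => isClosed_iInter fun y => isClosed_le ?_ continuous_const).inter
    (isClosed_iInter fun v => isClosed_iInter fun _ => isClosed_eq ?_ continuous_const)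
  · fun_prop
  · fun_prop

/-- Such maps vanish at `0`, so they form a closed subset of a product of compact balls of radius
`lam * ‖x‖`, to which Tychonoff applies. -/
theorem isCompact_lipschitzFixing (lam : ℝ≥0) (V : Submodule ℝ X) [FiniteDimensional ℝ V] {r : ℝ}
    (hr : 0 ≤ r) : IsCompact (lipschitzFixing lam V r) := by
  have : ProperSpace V := FiniteDimensional.proper ℝ V
  refine (isCompact_univ_pi fun x : X => isCompact_closedBall (0 : V) (lam * ‖x‖)).of_isClosed_subset
    (isClosed_lipschitzFixing lam V r) fun G hG x _ => ?_
  have h0 : G 0 = 0 := by simpa using hG.2 0 (by simpa using hr)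
  simpa [h0] using hG.1 x 0

/-- A finite-dimensional subspace that is a `lam`-Lipschitz retract is the range of a linear
projection of norm at most `lam`. -/
theorem exists_projection_of_lipschitz_retraction {lam : ℝ≥0} (V : Submodule ℝ X)
    [FiniteDimensional ℝ V] {F : X → V} (hF : ∀ x y, ‖F x - F y‖ ≤ lam * ‖x - y‖)
    (hFV : ∀ v : V, F v = v) :
    ∃ P : X →L[ℝ] V, ‖P‖ ≤ lam ∧ ∀ v : V, P v = v := by
  have hKc : IsCompact {G : X → V | (∀ x y, ‖G x - G y‖ ≤ lam * ‖x - y‖) ∧ ∀ v : V, G v = v} := by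
    have : ProperSpace V := FiniteDimensional.proper ℝ V
    refine (isCompact_lipschitzFixing lam V le_rfl).of_isClosed_subset ?_
      fun G hG => ⟨hG.1, fun v _ => hG.2 v⟩
    simp only [Set.ofPred_and, Set.ofPred_forall]
    refine (isClosed_iInter fun x => isClosed_iInter fun y => isClosed_le ?_
      continuous_const).inter (isClosed_iInter fun v => isClosed_eq ?_ continuous_const) <;> fun_prop
  have hKconv : Convex ℝ
      {G : X → V | (∀ x y, ‖G x - G y‖ ≤ lam * ‖x - y‖) ∧ ∀ v : V, G v = v} := by
    rw [Set.ofPred_and]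
    refine (convex_lipschitzMaps lam X V).inter fun G hG H hH a b _ _ hab v => ?_
    simp only [Set.mem_ofPred_eq] at hG hH
    simp [hG, hH, ← add_smul, hab]
  have hlip : ∀ (y : X) (G : X → V), (∀ x y, ‖G x - G y‖ ≤ lam * ‖x - y‖) →
      ∀ x z, ‖translateSub y G x - translateSub y G z‖ ≤ lam * ‖x - z‖ := by
    intro y G hG x z
    simpa using hG (x + y) (z + y)
  -- Only translations by vectors of `V` are known to preserve the condition of fixing `V`, so these
  -- are treated first.
  obtain ⟨G, hG, hGV⟩ := exists_common_fixedPoint_of_commute hKc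
    hKconv
    ⟨F, hF, hFV⟩ (fun v : V => translateSub (v : X)) (fun v w => translateSub_commute _ _)
    (fun v G hG => ⟨hlip _ G hG.1, fun w => by
      rw [translateSub_apply, ← Submodule.coe_add, hG.2, hG.2, add_sub_cancel_right]⟩)
  have hK'c : IsCompact ({G : X → V | (∀ x y, ‖G x - G y‖ ≤ lam * ‖x - y‖) ∧ ∀ v : V, G v = v} ∩
      {G | ∀ v : V, translateSub (v : X) G = G}) := by
    refine hKc.inter_right ?_
    simp only [Set.ofPred_forall]
    exact isClosed_iInter fun v => isClosed_eq (translateSub (v : X)).continuous continuous_id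
  -- Once `G (x + v) = G x + v` for `v` in `V`, every translation preserves the condition of fixing
  -- `V`.
  obtain ⟨P, ⟨⟨hP, hPV⟩, -⟩, hPX⟩ := exists_common_fixedPoint_of_commute hK'c
    (by
      refine hKconv.inter fun G hG H hH a b _ _ hab v => ?_
      simp only [Set.mem_ofPred_eq] at hG hH
      rw [map_add, map_smul, map_smul, hG, hH])
    ⟨G, hG, hGV⟩ (fun y : X => translateSub y) (fun y z => translateSub_commute y z)
    (fun y G hG => by
      have hfix : ∀ v : V, translateSub (v : X) (translateSub y G) = translateSub y G := by
        intro v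
        have := congrArg (fun L : (X → V) →L[ℝ] (X → V) => L G)
          (translateSub_commute (V := V) (v : X) y).eq
        exact this.trans (congrArg (translateSub y) (hG.2 v))
      refine ⟨⟨hlip y G hG.1.1, fun v => ?_⟩, hfix⟩
      have h := congrFun (hG.2 v) y
      rw [translateSub_apply, hG.1.2] at h
      rw [translateSub_apply, add_comm, ← h]
      abel)
  have hadd : ∀ x y, P (x + y) = P x + P y := fun x y => by
    have h := congrFun (hPX y) x
    rwa [translateSub_apply, sub_eq_iff_eq_add] at h
  have hLip : LipschitzWith lam P := LipschitzWith.of_dist_le_mul fun x y => by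
    simpa [dist_eq_norm] using hP x y
  let L : X →L[ℝ] V := (AddMonoidHom.mk' P hadd).toRealLinearMap hLip.continuous
  exact ⟨L, L.opNorm_le_of_lipschitz hLip, hPV⟩

/-- A convex set containing `0` has an interior point relative to its span if the latter is
finite-dimensional. -/
theorem exists_ball_subset_of_convex {C : Set X} (hC : Convex ℝ C) (h0 : (0 : X) ∈ C)
    [FiniteDimensional ℝ (Submodule.span ℝ C)] :
    ∃ c : Submodule.span ℝ C, ∃ r > 0, ∀ v : Submodule.span ℝ C,
      ‖v‖ ≤ r → ((c + v : Submodule.span ℝ C) : X) ∈ C := by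
  set V := Submodule.span ℝ C
  have hconv : Convex ℝ (((↑) : V → X) ⁻¹' C) := hC.linear_preimage V.subtype
  have hspan : Submodule.span ℝ (((↑) : V → X) ⁻¹' C) = ⊤ := Submodule.span_span_coe_preimage
  -- Because `0` lies in `C`, affine and linear span coincide.
  have haff : affineSpan ℝ (((↑) : V → X) ⁻¹' C) = ⊤ := by
    rw [AffineSubspace.affineSpan_eq_top_iff_vectorSpan_eq_top_of_nonempty ℝ V V ⟨0, h0⟩,
      vectorSpan_eq_span_vsub_set_right ℝ (p := (0 : V)) h0]
    simpa using hspan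
  obtain ⟨c, hc⟩ := hconv.interior_nonempty_iff_affineSpan_eq_top.2 haff
  obtain ⟨r, hr, hball⟩ := Metric.nhds_basis_closedBall.mem_iff.1 (mem_interior_iff_mem_nhds.1 hc)
  exact ⟨c, r, hr, fun v hv => hball (by simpa using hv)⟩

/-- The rescalings `t⁻¹ • (R (c + t • x) - c)` keep the Lipschitz constant and fix ever larger balls
of the span as `t` shrinks. Nested compactness replaces the limit. -/
theorem exists_projection_of_retraction_onto_convex {lam : ℝ≥0} {C : Set X} (hC : Convex ℝ C)
    (h0 : (0 : X) ∈ C) [FiniteDimensional ℝ (Submodule.span ℝ C)] {R : X → X}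
    (hR : IsLipschitzRetractionOnto lam C R) :
    ∃ P : X →L[ℝ] Submodule.span ℝ C, ‖P‖ ≤ lam ∧ ∀ v : Submodule.span ℝ C, P v = v := by
  obtain ⟨hRl, hRC, hRid⟩ := hR
  obtain ⟨c, r, hr, hball⟩ := exists_ball_subset_of_convex hC h0
  have hne : ∀ n : ℕ, (lipschitzFixing lam (Submodule.span ℝ C) (n : ℝ)).Nonempty := by
    -- A ball of radius `n` must shrink into the ball of radius `r`; `n + 1` avoids division by
    -- zero.
    intro n
    set t : ℝ := r / (n + 1) with ht
    have htpos : 0 < t := by positivity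
    let R' : X → Submodule.span ℝ C := fun x => ⟨R x, Submodule.subset_span (hRC x)⟩
    refine ⟨fun x => t⁻¹ • (R' (c + t • x) - c), fun x y => ?_, fun v hv => ?_⟩
    · have h1 : ‖R' (c + t • x) - R' (c + t • y)‖ ≤ lam * (t * ‖x - y‖) := by
        have := hRl.dist_le_mul (c + t • x) (c + t • y)
        rwa [dist_eq_norm, dist_eq_norm, add_sub_add_left_eq_sub, ← smul_sub, norm_smul,
          Real.norm_of_nonneg htpos.le] at this
      rw [← smul_sub, sub_sub_sub_cancel_right, norm_smul, norm_inv, Real.norm_of_nonneg htpos.le,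
        inv_mul_le_iff₀ htpos]
      linarith
    · have h2 : ‖t • v‖ ≤ r := by
        rw [norm_smul, Real.norm_of_nonneg htpos.le, ht, div_mul_eq_mul_div,
          div_le_iff₀ (by positivity)]
        exact mul_le_mul_of_nonneg_left (by linarith) hr.le
      have h3 : R' (c + t • v) = c + t • v := Subtype.ext (hRid _ (hball _ h2))
      simp [h3, smul_smul, htpos.ne']
  obtain ⟨F, hF⟩ := IsCompact.nonempty_iInter_of_sequence_nonempty_isCompact_isClosed
    (fun n : ℕ => lipschitzFixing lam (Submodule.span ℝ C) (n : ℝ))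
    (fun n G hG => ⟨hG.1, fun v hv => hG.2 v (hv.trans (by simp))⟩) hne
    (isCompact_lipschitzFixing lam _ (by simp)) (fun n => isClosed_lipschitzFixing lam _ _)
  rw [Set.mem_iInter] at hF
  refine exists_projection_of_lipschitz_retraction _ (hF 0).1 fun v => ?_
  obtain ⟨n, hn⟩ := exists_nat_ge ‖v‖
  exact (hF n).2 v hn

theorem tendsto_of_tendsto_dense {lam : ℝ≥0} {S : ℕ → X →L[ℝ] X} (hS : ∀ n, ‖S n‖ ≤ lam)
    {D : Set X} (hD : Dense D) (hSD : ∀ x ∈ D, Tendsto (fun n => S n x) atTop (𝓝 x)) (x : X) :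
    Tendsto (fun n => S n x) atTop (𝓝 x) := by
  rw [Metric.tendsto_atTop]
  intro ε hε
  -- Replacing `x` by `d` costs `(lam + 1) * dist x d` in total, less than `ε / 2`.
  obtain ⟨d, hd, hxd⟩ := hD.exists_dist_lt x (ε := ε / (2 * (lam + 1))) (by positivity)
  obtain ⟨N, hN⟩ := Metric.tendsto_atTop.1 (hSD d hd) (ε / 2) (by positivity)
  refine ⟨N, fun n hn => ?_⟩
  have h1 : dist (S n x) (S n d) ≤ lam * dist x d := by
    rw [dist_eq_norm, dist_eq_norm, ← map_sub]
    exact (S n).le_of_opNorm_le (hS n) _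
  have h2 := dist_triangle4 (S n x) (S n d) d x
  have h3 := hN n hn
  rw [dist_comm d x] at h2
  rw [lt_div_iff₀ (by positivity)] at hxd
  nlinarith

theorem HasLipschitzPiProperty.hasIncreasingPiProperty {lam : ℝ≥0}
    (h : HasLipschitzPiProperty X lam) : HasIncreasingPiProperty X lam := by
  obtain ⟨C, hmono, hconv, h0, hfin, hdense, hretr⟩ := h
  have hP : ∀ n, ∃ P : X →L[ℝ] Submodule.span ℝ (C n), ‖P‖ ≤ lam ∧
      ∀ v : Submodule.span ℝ (C n), P v = v := fun n => by
    obtain ⟨R, hR⟩ := hretr n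
    exact exists_projection_of_retraction_onto_convex (hconv n) (h0 n) hR
  choose P hPn hPid using hP
  have hfix : ∀ n m, n ≤ m → ∀ x ∈ Submodule.span ℝ (C n), (P m x : X) = x := fun n m hnm x hx =>
    congrArg Subtype.val (hPid m ⟨x, Submodule.span_mono (hmono hnm) hx⟩)
  have hnorm : ∀ n, ‖(Submodule.span ℝ (C n)).subtypeL ∘L P n‖ ≤ lam := fun n =>
    ContinuousLinearMap.opNorm_le_bound _ lam.2 fun x => (P n).le_of_opNorm_le (hPn n) x
  refine ⟨fun n => (Submodule.span ℝ (C n)).subtypeL ∘L P n, fun n => ?_, fun n => ?_, hnorm, ?_,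
    fun n m hnm => ?_⟩
  · ext x
    exact hfix n n le_rfl _ (P n x).2
  · refine Submodule.finiteDimensional_of_le (S₂ := Submodule.span ℝ (C n)) ?_
    rintro _ ⟨x, rfl⟩
    exact (P n x).2
  · refine tendsto_of_tendsto_dense hnorm (dense_iff_closure_eq.2 hdense) fun x hx => ?_
    obtain ⟨n, hn⟩ := Set.mem_iUnion.1 hx
    exact tendsto_const_nhds.congr' (eventually_atTop.2 ⟨n, fun m hm => (hfix n m hm x hn).symm⟩)
  · ext x
    exact hfix n m hnm _ (P n x).2

theorem HasIncreasingPiProperty.hasLipschitzPiProperty {lam : ℝ≥0}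
    (h : HasIncreasingPiProperty X lam) : HasLipschitzPiProperty X lam := by
  obtain ⟨S, hproj, hfin, hnorm, hlim, hincr⟩ := h
  have hspan : ∀ n, Submodule.span ℝ ((S n).range : Set X) = (S n).range := fun n =>
    Submodule.span_eq _
  refine ⟨fun n => (S n).range, fun n m hnm => ?_, fun n => (S n).range.convex,
    fun n => (S n).range.zero_mem, fun n => ?_, ?_, fun n => ⟨S n, ?_, fun x => ⟨x, rfl⟩, ?_⟩⟩
  · rintro _ ⟨x, rfl⟩
    exact ⟨S n x, congrArg (fun L : X →L[ℝ] X => L x) (hincr n m hnm)⟩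
  · rw [hspan]
    exact hfin n
  · refine Set.eq_univ_of_forall fun x => mem_closure_of_tendsto (hlim x) ?_
    exact Eventually.of_forall fun n =>
      Set.mem_iUnion.2 ⟨n, Submodule.subset_span ⟨x, rfl⟩⟩
  · exact (S n).lipschitz.weaken (hnorm n)
  · rintro _ ⟨x, rfl⟩
    exact congrArg (fun L : X →L[ℝ] X => L x) (hproj n)

end Retraction

theorem HasIncreasingPiProperty.hasPiProperty.{u} {X : Type u} [NormedAddCommGroup X]
    [NormedSpace ℝ X] {lam : ℝ≥0} (h : HasIncreasingPiProperty X lam) : HasPiProperty X lam := by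
  obtain ⟨S, hproj, hfin, hnorm, hlim, -⟩ := h
  -- The index set must live in the universe of `X`.
  refine ⟨ULift.{u} ℕ, inferInstance, ⟨fun a b => ⟨⟨max a.down b.down⟩, le_max_left a.down b.down,
    le_max_right a.down b.down⟩⟩, inferInstance,
    fun i => S i.down, fun i => hproj _, fun i => hfin _, fun i => hnorm _, fun x => ?_⟩
  refine (hlim x).comp (tendsto_atTop.2 fun n => ?_)
  exact eventually_atTop.2 ⟨⟨n⟩, fun i hi => hi⟩

/-! ### Perturbing projections to obtain increasing ranges -/

section Perturbation

variable {X : Type*} [NormedAddCommGroup X] [NormedSpace ℝ X]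

/-- Pointwise convergence to `0` on the finite-dimensional range of `Q` makes the compositions
with `Q` converge to `0` in norm. -/
theorem tendsto_comp_of_finiteDimensional {ι : Type*} {l : Filter ι} {E : Submodule ℝ X}
    [FiniteDimensional ℝ E] (Q : X →L[ℝ] E) {A : ι → X →L[ℝ] X}
    (hA : ∀ x, Tendsto (fun i => A i x) l (𝓝 0)) :
    Tendsto (fun i => A i ∘L E.subtypeL ∘L Q) l (𝓝 0) := by
  let b := Module.finBasis ℝ E
  let f : Fin (Module.finrank ℝ E) → X →L[ℝ] ℝ := fun j =>
    (LinearMap.toContinuousLinearMap (b.coord j)) ∘L Q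
  have hsum : ∀ i, A i ∘L E.subtypeL ∘L Q = ∑ j, (f j).smulRight (A i (b j)) := by
    intro i
    ext x
    have hx : (Q x : X) = ∑ j, b.coord j (Q x) • (b j : X) := by
      have := congrArg E.subtype (b.sum_repr (Q x))
      simpa only [map_sum, map_smul, Submodule.subtype_apply, Module.Basis.coord_apply] using this.symm
    simp [hx, f]
  simp only [hsum]
  rw [← Finset.sum_const_zero (s := (Finset.univ : Finset (Fin (Module.finrank ℝ E))))]
  refine tendsto_finsetSum _ fun j _ => ?_
  rw [tendsto_zero_iff_norm_tendsto_zero]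
  simpa [ContinuousLinearMap.norm_smulRight_apply] using ((hA (b j)).norm.const_mul ‖f j‖)

theorem exists_projection_fixing_of_net [CompleteSpace X] {lam mu : ℝ≥0} (hlt : lam < mu)
    (h : HasPiProperty X lam) (E : Submodule ℝ X) [FiniteDimensional ℝ E] :
    ∃ P : X →L[ℝ] X, P ∘L P = P ∧ FiniteDimensional ℝ P.range ∧ ‖P‖ ≤ mu ∧ ∀ x ∈ E, P x = x := by
  obtain ⟨ι, _, _, _, S, hproj, hfin, hnorm, hlim⟩ := h
  obtain ⟨Q, hQ⟩ := Submodule.ClosedComplemented.of_finiteDimensional E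
  -- `T i` agrees with `S i` on `E` and tends to `1` in norm, so it is eventually invertible. On
  -- `E`, `S i * T i = T i`, hence `(T i)⁻¹ * S i * T i` fixes `E`.
  let T : ι → X →L[ℝ] X := fun i => 1 + (S i - 1) ∘L E.subtypeL ∘L Q
  have hT : Tendsto T atTop (𝓝 1) := by
    have := (tendsto_comp_of_finiteDimensional Q (A := fun i => S i - 1) (l := atTop)
      fun x => by simpa using (hlim x).sub_const x).const_add 1
    rwa [add_zero] at this
  have hTinv : Tendsto (fun i => Ring.inverse (T i)) atTop (𝓝 1) := by
    have := NormedRing.inverse_continuousAt (1 : (X →L[ℝ] X)ˣ)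
    rw [Units.val_one] at this
    simpa [Function.comp_def] using this.tendsto.comp hT
  have hunit : ∀ᶠ i in atTop, IsUnit (T i) := hT.eventually (Units.isOpen.mem_nhds isUnit_one)
  have hbound : ∀ᶠ i in atTop, ‖Ring.inverse (T i)‖ * lam * ‖T i‖ ≤ mu := by
    have h1 := (hTinv.norm.mul_const (lam : ℝ)).mul hT.norm
    -- Equality fails when `X` is trivial.
    have hone : ‖(1 : X →L[ℝ] X)‖ ≤ 1 := ContinuousLinearMap.norm_id_le
    have h2 : ‖(1 : X →L[ℝ] X)‖ * lam * ‖(1 : X →L[ℝ] X)‖ < mu := by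
      refine lt_of_le_of_lt ?_ (NNReal.coe_lt_coe.2 hlt)
      calc _ ≤ 1 * (lam : ℝ) * 1 := by gcongr
        _ = lam := by ring
    exact (h1.eventually (gt_mem_nhds h2)).mono fun _ h => h.le
  obtain ⟨i, hi, hb⟩ := (hunit.and hbound).exists
  have hTE : ∀ x ∈ E, T i x = S i x := fun x hx => by
    simp [T, hQ ⟨x, hx⟩]
  have hleft : Ring.inverse (T i) * T i = 1 := Ring.inverse_mul_cancel _ hi
  have hright : T i * Ring.inverse (T i) = 1 := Ring.mul_inverse_cancel _ hi
  have hS : S i * S i = S i := hproj i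
  refine ⟨Ring.inverse (T i) * S i * T i, ?_, ?_, ?_, fun x hx => ?_⟩
  · change Ring.inverse (T i) * S i * T i * (Ring.inverse (T i) * S i * T i) = _
    calc _ = Ring.inverse (T i) * S i * (T i * Ring.inverse (T i)) * S i * T i := by
          simp only [mul_assoc]
      _ = _ := by rw [hright, mul_one, mul_assoc _ (S i) (S i), hS]
  · have := hfin i
    refine Submodule.finiteDimensional_of_le
      (S₂ := (S i).range.map (Ring.inverse (T i)).toLinearMap) ?_
    rintro _ ⟨x, rfl⟩
    exact ⟨S i (T i x), ⟨_, rfl⟩, rfl⟩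
  · refine le_trans ((norm_mul_le _ _).trans ?_) hb
    gcongr
    exact (norm_mul_le _ _).trans (by gcongr; exact hnorm i)
  · change Ring.inverse (T i) (S i (T i x)) = x
    rw [hTE x hx, show S i (S i x) = S i x from congrArg (fun L : X →L[ℝ] X => L x) hS,
      ← hTE x hx]
    exact congrArg (fun L : X →L[ℝ] X => L x) hleft

theorem HasPiProperty.hasIncreasingPiProperty [CompleteSpace X]
    [TopologicalSpace.SeparableSpace X] {lam mu : ℝ≥0} (h : HasPiProperty X lam)
    (hlt : lam < mu) : HasIncreasingPiProperty X mu := by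
  let Good := {P : X →L[ℝ] X // P ∘L P = P ∧ FiniteDimensional ℝ P.range ∧ ‖P‖ ≤ mu}
  have step : ∀ (P : Good) (x : X), ∃ P' : Good, P'.1 ∘L P.1 = P.1 ∧ P'.1 x = x := by
    rintro ⟨P, -, hfin, -⟩ x
    obtain ⟨P', h1, h2, h3, h4⟩ :=
      exists_projection_fixing_of_net hlt h (P.range ⊔ Submodule.span ℝ {x})
    refine ⟨⟨P', h1, h2, h3⟩, ?_, ?_⟩
    · ext y
      exact h4 _ (Submodule.mem_sup_left ⟨y, rfl⟩)
    · exact h4 _ (Submodule.mem_sup_right (Submodule.mem_span_singleton_self x))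
  choose next hnext hnextx using step
  obtain ⟨P₀, h1, h2, h3, -⟩ := exists_projection_fixing_of_net hlt h ⊥
  let d := TopologicalSpace.denseSeq X
  -- `S (k + 1)` fixes the range of `S k` and `d k`, so all later projections fix `d k`.
  let S : ℕ → Good := fun n => Nat.rec ⟨P₀, h1, h2, h3⟩ (fun k P => next P (d k)) n
  have hS : ∀ n m, n ≤ m → (S m).1 ∘L (S n).1 = (S n).1 := by
    intro n m hnm
    induction m, hnm using Nat.le_induction with
    | base => exact (S n).2.1
    | succ m _ ih =>
      rw [← ih, ← ContinuousLinearMap.comp_assoc]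
      exact congrArg (· ∘L (S n).1) (hnext (S m) (d m))
  refine ⟨fun n => (S n).1, fun n => (S n).2.1, fun n => (S n).2.2.1, fun n => (S n).2.2.2,
    tendsto_of_tendsto_dense (fun n => (S n).2.2.2) (TopologicalSpace.denseRange_denseSeq X) ?_, hS⟩
  rintro _ ⟨k, rfl⟩
  refine tendsto_const_nhds.congr' (eventually_atTop.2 ⟨k + 1, fun m hm => ?_⟩)
  have hk : (S (k + 1)).1 (d k) = d k := hnextx (S k) (d k)
  have := congrArg (fun L : X →L[ℝ] X => L (d k)) (hS (k + 1) m hm)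
  simp only [ContinuousLinearMap.comp_apply, hk] at this
  exact this.symm

end Perturbation

theorem mainTheorem7 {X : Type*} [NormedAddCommGroup X] [NormedSpace ℝ X] [CompleteSpace X]
    [TopologicalSpace.SeparableSpace X] (lam : ℝ≥0) (hlam : 0 < lam) :
    (HasLipschitzPiProperty X lam ↔ HasIncreasingPiProperty X lam) ∧
    (HasLipschitzPiProperty X lam → HasPiProperty X lam) ∧
    (HasPiProperty X lam → ∀ mu : ℝ≥0, lam < mu → HasLipschitzPiProperty X mu) :=
  ⟨⟨fun h => h.hasIncreasingPiProperty, fun h => h.hasLipschitzPiProperty⟩,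
    fun h => h.hasIncreasingPiProperty.hasPiProperty,
    fun h _ hmu => (h.hasIncreasingPiProperty hmu).hasLipschitzPiProperty⟩
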